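/- Throughout, Banach spaces are over $\mathbb K\in\{\mathbb R,\mathbb C\}$, an operator is a bounded linear map, and $\mathscr B(X,Y)$ is the space of operators from $X$ to $Y$, with $\mathscr B(X)=\mathscr B(X,X)$. An operator $T\in\mathscr B(X,Y)$ is Fredholm if $\ker T$ and $Y/\operatorname{ran}T$ are finite-dimensional; its index is $\dim\ker T-\dim Y/\operatorname{ran}T$. For $k\in\mathbb Z$, $\Phi_k(X)$ is the set of Fredholm operators of index $k$ on $X$, and $\mathbb I_\Phi(X)=\{k\in\mathbb Z:\Phi_k(X)\neq\emptyset\}$. Operators $U\in\mathscr B(X)$ and $V\in\mathscr B(Y)$ are Schur coupled if there are isomorphisms $A\in\mathscr B(X)$ and $D\in\mathscr B(Y)$ and operators $B\in\mathscr B(Y,X)$ and $C\in\mathscr B(X,Y)$ with $U=A-BD^{-1}C$ and $V=D-CA^{-1}B$. Let $\mathbb I_{\mathrm{SC}}(X,Y)$ be the set of $k\in\mathbb Z$ for which there are Schur coupled operators $U\in\Phi_k(X)$ and $V\in\Phi_k(Y)$. Let $\operatorname{sc}(X,Y)$ be the least positive element of $\mathbb I_{\mathrm{SC}}(X,Y)$,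 and $\operatorname{eae}(X,Y)$ the least positive element of $\mathbb I_\Phi(X)\cap\mathbb I_\Phi(Y)$, each being $0$ if there is no positive element. Banach spaces $X$ and $Y$ are essentially incomparable if $I_X-ST$ is a Fredholm operator for every $S\in\mathscr B(Y,X)$ and $T\in\mathscr B(X,Y)$. **Proposition 1.9.** Let $X$ and $Y$ be Banach spaces over the same scalar field with decompositions $X=X_1\oplus X_2$ and $Y=Y_1\oplus Y_2$ into closed subspaces, where $X_2$ and $Y_2$ are isomorphic and $X_1$, $X_2$ and $Y_1$ are pairwise essentially incomparable. Then $$\mathbb I_{\mathrm{SC}}(X,Y)=\mathbb I_\Phi(X_2),$$ and consequently $\operatorname{sc}(X,Y)=\operatorname{eae}(X_2,Y_2)$. -/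

import Mathlib

namespace SchurFredholm

section Definitions

variable {𝕜 : Type*} [RCLike 𝕜]

/-- The Fredholm index `dim ker T - dim (Y / ran T)`, as an integer. It is only used for Fredholm
operators, for which both dimensions are finite. -/
noncomputable def index {X Y : Type*} [NormedAddCommGroup X] [NormedSpace 𝕜 X]
    [NormedAddCommGroup Y] [NormedSpace 𝕜 Y] (T : X →L[𝕜] Y) : ℤ :=
  (Module.finrank 𝕜 T.ker : ℤ) - (Module.finrank 𝕜 (Y ⧸ T.range) : ℤ)

/-- `Φ_k(X, Y)`: the Fredholm operators of index `k` from `X` to `Y`. -/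
def fredholmOfIndex (𝕜 : Type*) [RCLike 𝕜] (X Y : Type*)
    [NormedAddCommGroup X] [NormedSpace 𝕜 X] [NormedAddCommGroup Y] [NormedSpace 𝕜 Y] (k : ℤ) :
    Set (X →L[𝕜] Y) :=
  {T | T.IsFredholm ∧ index T = k}

/-- `𝕀_Φ(X)`: the integers that occur as indices of Fredholm operators on `X`. -/
def fredholmIndices (𝕜 : Type*) [RCLike 𝕜] (X : Type*)
    [NormedAddCommGroup X] [NormedSpace 𝕜 X] : Set ℤ :=
  {k | (fredholmOfIndex 𝕜 X X k).Nonempty}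

/-- `U` on `X` and `V` on `Y` are Schur coupled: `U = A - B D⁻¹ C` and `V = D - C A⁻¹ B` for some
isomorphisms `A` of `X` and `D` of `Y` and some operators `B : Y → X` and `C : X → Y`. -/
def SchurCoupled {X Y : Type*} [NormedAddCommGroup X] [NormedSpace 𝕜 X]
    [NormedAddCommGroup Y] [NormedSpace 𝕜 Y] (U : X →L[𝕜] X) (V : Y →L[𝕜] Y) : Prop :=
  ∃ (A : X ≃L[𝕜] X) (D : Y ≃L[𝕜] Y) (B : Y →L[𝕜] X) (C : X →L[𝕜] Y),
    U = (A : X →L[𝕜] X) - B ∘L (D.symm : Y →L[𝕜] Y) ∘L C ∧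
    V = (D : Y →L[𝕜] Y) - C ∘L (A.symm : X →L[𝕜] X) ∘L B

/-- `SC_k(X, Y)`: the pairs of Schur coupled Fredholm operators of index `k`. -/
def schurCoupledPairs (𝕜 : Type*) [RCLike 𝕜] (X Y : Type*)
    [NormedAddCommGroup X] [NormedSpace 𝕜 X] [NormedAddCommGroup Y] [NormedSpace 𝕜 Y] (k : ℤ) :
    Set ((X →L[𝕜] X) × (Y →L[𝕜] Y)) :=
  {p | p.1 ∈ fredholmOfIndex 𝕜 X X k ∧ p.2 ∈ fredholmOfIndex 𝕜 Y Y k ∧ SchurCoupled p.1 p.2}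

/-- `𝕀_SC(X, Y)`: the integers `k` for which `SC_k(X, Y)` is non-empty. -/
def schurIndices (𝕜 : Type*) [RCLike 𝕜] (X Y : Type*)
    [NormedAddCommGroup X] [NormedSpace 𝕜 X] [NormedAddCommGroup Y] [NormedSpace 𝕜 Y] : Set ℤ :=
  {k | (schurCoupledPairs 𝕜 X Y k).Nonempty}

/-- The least positive element of a set of integers, and `0` if there is no positive element
(the infimum of the empty set of natural numbers is `0`). -/
noncomputable def leastPositive (I : Set ℤ) : ℕ :=
  sInf {n : ℕ | 0 < n ∧ (n : ℤ) ∈ I}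

/-- The numerical index `eae(X, Y)`. -/
noncomputable def eae (𝕜 : Type*) [RCLike 𝕜] (X Y : Type*)
    [NormedAddCommGroup X] [NormedSpace 𝕜 X] [NormedAddCommGroup Y] [NormedSpace 𝕜 Y] : ℕ :=
  leastPositive (fredholmIndices 𝕜 X ∩ fredholmIndices 𝕜 Y)

/-- The numerical index `sc(X, Y)`. -/
noncomputable def sc (𝕜 : Type*) [RCLike 𝕜] (X Y : Type*)
    [NormedAddCommGroup X] [NormedSpace 𝕜 X] [NormedAddCommGroup Y] [NormedSpace 𝕜 Y] : ℕ :=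
  leastPositive (schurIndices 𝕜 X Y)

/-- `X` and `Y` are essentially incomparable: `I_X - S T` is a Fredholm operator for all operators
`S : Y → X` and `T : X → Y`. -/
def EssentiallyIncomparable (𝕜 : Type*) [RCLike 𝕜] (X Y : Type*)
    [NormedAddCommGroup X] [NormedSpace 𝕜 X] [NormedAddCommGroup Y] [NormedSpace 𝕜 Y] : Prop :=
  ∀ (S : Y →L[𝕜] X) (T : X →L[𝕜] Y), (ContinuousLinearMap.id 𝕜 X - S ∘L T).IsFredholm

end Definitions

/-- If there is no positive element, `leastPositive` is `0`. -/
theorem leastPositive_of_empty {I : Set ℤ} (h : ∀ n : ℕ, 0 < n → (n : ℤ) ∉ I) :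
    leastPositive I = 0 := by
  have : {n : ℕ | 0 < n ∧ (n : ℤ) ∈ I} = ∅ := by
    ext n
    simpa using h n
  simp [leastPositive, this]

/-- Otherwise `leastPositive` is the minimum of the positive elements. -/
theorem isLeast_leastPositive {I : Set ℤ} (h : ∃ n : ℕ, 0 < n ∧ (n : ℤ) ∈ I) :
    IsLeast {n : ℕ | 0 < n ∧ (n : ℤ) ∈ I} (leastPositive I) :=
  ⟨Nat.sInf_mem h, fun _ hn => Nat.sInf_le hn⟩

/-- Between Banach spaces, Mathlib's Fredholm operators are the operators whose kernel and cokernel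
are finite-dimensional. -/
theorem isFredholm_iff {𝕜 : Type*} [RCLike 𝕜] {X Y : Type*}
    [NormedAddCommGroup X] [NormedSpace 𝕜 X] [CompleteSpace X]
    [NormedAddCommGroup Y] [NormedSpace 𝕜 Y] [CompleteSpace Y] (T : X →L[𝕜] Y) :
    T.IsFredholm ↔ FiniteDimensional 𝕜 T.ker ∧ FiniteDimensional 𝕜 (Y ⧸ T.range) := by
  refine ⟨fun h => ⟨h.finite_ker, h.finite_coker⟩, fun ⟨hk, hc⟩ => ?_⟩
  obtain ⟨A, hA⟩ := Submodule.exists_isCompl T.range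
  have : FiniteDimensional 𝕜 A :=
    (Submodule.quotientEquivOfIsCompl T.range A hA).finiteDimensional
  have : IsClosed (A : Set Y) := A.closed_of_finiteDimensional
  have hsurj : Function.Surjective (A.mkQL ∘L T) := by
    intro q
    obtain ⟨y, rfl⟩ := A.mkQ_surjective q
    have hy : y ∈ T.range ⊔ A := hA.sup_eq_top ▸ Submodule.mem_top
    obtain ⟨_, ⟨x, rfl⟩, a, ha, rfl⟩ := Submodule.mem_sup.mp hy
    exact ⟨x, by simpa using ha⟩
  have hquot := ContinuousLinearMap.isQuotientMap (A.mkQL ∘L T) hsurj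
  have h := (ContinuousLinearMap.isStrictMap_isClosed_range_iff_quotient T A
    (Submodule.ClosedComplemented.of_finiteDimensional A)).mpr
      ⟨hquot.isStrictMap, by
        rw [LinearMap.range_eq_top.mpr hsurj]
        exact isClosed_univ⟩
  exact ⟨h.1, h.2, hk, hc, .of_finiteDimensional _⟩

end SchurFredholm

namespace SchurFredholm

open Filter Topology

section Algebra

variable {K V W V' W' : Type*} [Field K] [AddCommGroup V] [Module K V] [AddCommGroup W] [Module K W]
  [AddCommGroup V'] [Module K V'] [AddCommGroup W'] [Module K W']

/-- The kernel and the cokernel of `f` are finite-dimensional, and the difference of their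
dimensions is `k`. -/
def HasFredholmIndex (f : V →ₗ[K] W) (k : ℤ) : Prop :=
  FiniteDimensional K (LinearMap.ker f) ∧ FiniteDimensional K (W ⧸ LinearMap.range f) ∧
    (Module.finrank K (LinearMap.ker f) : ℤ) - Module.finrank K (W ⧸ LinearMap.range f) = k

theorem hasFredholmIndex_congr {f : V →ₗ[K] W} {g : V' →ₗ[K] W'}
    (ek : LinearMap.ker f ≃ₗ[K] LinearMap.ker g)
    (ec : (W ⧸ LinearMap.range f) ≃ₗ[K] (W' ⧸ LinearMap.range g)) (k : ℤ) :
    HasFredholmIndex f k ↔ HasFredholmIndex g k := by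
  rw [HasFredholmIndex, HasFredholmIndex, ek.finrank_eq, ec.finrank_eq]
  exact and_congr (Module.Finite.equiv_iff ek) (and_congr (Module.Finite.equiv_iff ec) Iff.rfl)

theorem hasFredholmIndex_conj (f : V →ₗ[K] W) (g : V' →ₗ[K] W') (e₁ : V ≃ₗ[K] V')
    (e₂ : W ≃ₗ[K] W') (h : ∀ x, e₂ (f x) = g (e₁ x)) (k : ℤ) :
    HasFredholmIndex f k ↔ HasFredholmIndex g k := by
  refine hasFredholmIndex_congr (e₁.ofSubmodules _ _ ?_) (Submodule.Quotient.equiv _ _ e₂ ?_) k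
  · ext y
    obtain ⟨x, rfl⟩ := e₁.surjective y
    simp [← h]
  · ext y
    constructor
    · rintro ⟨_, ⟨x, rfl⟩, rfl⟩
      exact ⟨e₁ x, (h x).symm⟩
    · rintro ⟨x, rfl⟩
      exact ⟨_, ⟨e₁.symm x, rfl⟩, by simpa using h (e₁.symm x)⟩

/-- A block operator with invertible upper left corner has the index of its Schur complement. -/
theorem hasFredholmIndex_schurComplement (M : V × V' →ₗ[K] W × W') (a : V ≃ₗ[K] W)
    (b : V' →ₗ[K] W) (c : V →ₗ[K] W') (d : V' →ₗ[K] W')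
    (hM : ∀ v x, M (v, x) = (a v + b x, c v + d x)) (k : ℤ) :
    HasFredholmIndex M k ↔ HasFredholmIndex (d - c ∘ₗ (a.symm : W →ₗ[K] V) ∘ₗ b) k := by
  set s := d - c ∘ₗ (a.symm : W →ₗ[K] V) ∘ₗ b with hs
  have hker : ∀ v x, M (v, x) = 0 ↔ v = - a.symm (b x) ∧ s x = 0 := by
    intro v x
    rw [hM, Prod.mk_eq_zero]
    have h1 : a v + b x = 0 ↔ v = - a.symm (b x) := by
      rw [← map_neg, LinearEquiv.eq_symm_apply, eq_neg_iff_add_eq_zero]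
    rw [h1]
    refine and_congr_right ?_
    rintro rfl
    simp [hs, sub_eq_add_neg, add_comm]
  have hmaps : ∀ p ∈ LinearMap.ker M, (LinearMap.snd K V V') p ∈ LinearMap.ker s := by
    rintro ⟨v, x⟩ hp
    exact ((hker v x).mp hp).2
  let φ : W × W' →ₗ[K] W' ⧸ LinearMap.range s :=
    (LinearMap.range s).mkQ ∘ₗ
      (LinearMap.snd K W W' - c ∘ₗ (a.symm : W →ₗ[K] V) ∘ₗ LinearMap.fst K W W')
  have hφ : Function.Surjective φ := by
    intro q
    obtain ⟨y, rfl⟩ := (LinearMap.range s).mkQ_surjective q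
    exact ⟨(0, y), by simp [φ]⟩
  have hφk : LinearMap.range M = LinearMap.ker φ := by
    ext ⟨w, y⟩
    simp only [φ, LinearMap.mem_ker, LinearMap.comp_apply, Submodule.mkQ_apply,
      Submodule.Quotient.mk_eq_zero, LinearMap.mem_range]
    constructor
    · rintro ⟨⟨v, x⟩, h⟩
      rw [hM, Prod.mk.injEq] at h
      refine ⟨x, ?_⟩
      simp [hs, ← h.1, ← h.2]
    · rintro ⟨x, h⟩
      refine ⟨(a.symm (w - b x), x), ?_⟩
      rw [hM]
      simp only [hs, LinearMap.sub_apply, LinearMap.comp_apply, LinearMap.snd_apply,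
        LinearMap.fst_apply, LinearEquiv.coe_coe] at h
      rw [Prod.mk.injEq]
      refine ⟨by simp, ?_⟩
      rw [map_sub, map_sub, ← sub_eq_zero]
      rw [← sub_eq_zero] at h
      rw [← h]
      abel
  refine hasFredholmIndex_congr
    (LinearEquiv.ofBijective ((LinearMap.snd K V V').restrict hmaps) ⟨?_, ?_⟩)
    ((Submodule.quotEquivOfEq _ _ hφk).trans (φ.quotKerEquivOfSurjective hφ)) k
  · rw [← LinearMap.ker_eq_bot, LinearMap.ker_eq_bot']
    rintro ⟨⟨v, x⟩, hp⟩ h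
    have hx : x = 0 := congrArg Subtype.val h
    have hv := ((hker v x).mp hp).1
    subst hx
    simp only [map_zero, neg_zero] at hv
    subst hv
    rfl
  · rintro ⟨x, hx⟩
    exact ⟨⟨(- a.symm (b x), x), (hker _ _).mpr ⟨rfl, hx⟩⟩, rfl⟩

theorem hasFredholmIndex_of_finiteDimensional [FiniteDimensional K V] [FiniteDimensional K W]
    (f : V →ₗ[K] W) :
    HasFredholmIndex f ((Module.finrank K V : ℤ) - Module.finrank K W) := by
  refine ⟨inferInstance, inferInstance, ?_⟩
  have h1 := LinearMap.finrank_range_add_finrank_ker f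
  have h2 := (LinearMap.range f).finrank_quotient_add_finrank
  omega

theorem HasFredholmIndex.unique {f : V →ₗ[K] W} {k l : ℤ} (hk : HasFredholmIndex f k)
    (hl : HasFredholmIndex f l) : k = l :=
  hk.2.2.symm.trans hl.2.2

end Algebra

section Analysis

variable {𝕜 : Type*} [RCLike 𝕜]
  {X : Type*} [NormedAddCommGroup X] [NormedSpace 𝕜 X]
  {Y : Type*} [NormedAddCommGroup Y] [NormedSpace 𝕜 Y]
  {Z : Type*} [NormedAddCommGroup Z] [NormedSpace 𝕜 Z]

open LinearMap.FiniteRangeSetoid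

theorem isFredholm_comp {T : X →L[𝕜] Y} {S : Y →L[𝕜] Z} (hS : S.IsFredholm)
    (hT : T.IsFredholm) : (S ∘L T).IsFredholm := by
  obtain ⟨s, hs⟩ := hS.exists_isQuasiInverse
  obtain ⟨t, ht⟩ := hT.exists_isQuasiInverse
  exact .of_isQuasiInverse (v := t ∘L s) (ht.comp hs)

theorem isFredholm_of_equiv {T T' : X →L[𝕜] Y} (hT : T.IsFredholm)
    (h : (T' : X →ₗ[𝕜] Y) ≈ (T : X →ₗ[𝕜] Y)) : T'.IsFredholm := by
  obtain ⟨t, ht⟩ := hT.exists_isQuasiInverse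
  exact .of_isQuasiInverse (v := t) (ht.congr (Setoid.refl _) h)

variable [CompleteSpace X]

/-- The decompositions of a Fredholm package as isomorphisms with products. -/
theorem exists_fredholm_normal_form {T : X →L[𝕜] Y} (hT : T.IsFredholm) :
    ∃ (X₁ X₀ : Submodule 𝕜 X) (Y₁ Y₀ : Submodule 𝕜 Y) (_ : CompleteSpace X₁)
      (_ : FiniteDimensional 𝕜 X₀) (_ : FiniteDimensional 𝕜 Y₀)
      (e : (X₁ × X₀) ≃L[𝕜] X) (f : (Y₁ × Y₀) ≃L[𝕜] Y) (a : X₁ ≃L[𝕜] Y₁),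
      ∀ v x, T (e (v, x)) = f (a v, 0) := by
  obtain ⟨p⟩ := hT.nonempty_fredholmPackage
  have hX₁ : IsClosed (p.decDom.X₁ : Set X) := p.decDom.isTopCompl.isClosed
  refine ⟨p.decDom.X₁, p.decDom.X₀, p.decCodom.X₁, p.decCodom.X₀, hX₁.completeSpace_coe,
    p.decDom.finite_X₀, p.decCodom.finite_X₀,
    Submodule.prodEquivOfIsTopCompl _ _ p.decDom.isTopCompl,
    Submodule.prodEquivOfIsTopCompl _ _ p.decCodom.isTopCompl, p.equiv, fun v x => ?_⟩
  have hx : T x = 0 := by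
    have : (x : X) ∈ T.ker := by rw [p.ker_eq]; exact x.2
    exact this
  have hv : T v = p.equiv v := by
    have := congrArg (fun R : X →L[𝕜] Y => R v) p.eq_equiv
    simpa using this
  simp [hx, hv]

variable [CompleteSpace Y]

theorem mem_fredholmOfIndex_iff {T : X →L[𝕜] Y} {k : ℤ} :
    T ∈ fredholmOfIndex 𝕜 X Y k ↔ HasFredholmIndex (T : X →ₗ[𝕜] Y) k := by
  rw [fredholmOfIndex, Set.mem_ofPred_eq, isFredholm_iff, and_assoc]
  rfl

theorem hasFredholmIndex_index {T : X →L[𝕜] Y} (hT : T.IsFredholm) :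
    HasFredholmIndex (T : X →ₗ[𝕜] Y) (index T) :=
  mem_fredholmOfIndex_iff.mp ⟨hT, rfl⟩

/-- Operators near a Fredholm operator are Fredholm with the same index. -/
theorem eventually_hasFredholmIndex {T : X →L[𝕜] Y} {k : ℤ}
    (hT : HasFredholmIndex (T : X →ₗ[𝕜] Y) k) :
    ∀ᶠ T' : X →L[𝕜] Y in 𝓝 T, HasFredholmIndex (T' : X →ₗ[𝕜] Y) k := by
  obtain ⟨X₁, X₀, Y₁, Y₀, _, _, _, e, f, a, h⟩ :=
    exists_fredholm_normal_form (mem_fredholmOfIndex_iff.mpr hT).1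
  let corner : (X →L[𝕜] Y) → (X₁ →L[𝕜] Y₁) := fun R =>
    (ContinuousLinearMap.fst 𝕜 Y₁ Y₀) ∘L (f.symm : Y →L[𝕜] Y₁ × Y₀) ∘L R ∘L
      (e : X₁ × X₀ →L[𝕜] X) ∘L (ContinuousLinearMap.inl 𝕜 X₁ X₀)
  have hcont : Continuous corner := by fun_prop
  have hcorner : corner T = a := by
    ext v
    simp [corner, h]
  have key : ∀ R : X →L[𝕜] Y, corner R ∈ Set.range ((↑) : (X₁ ≃L[𝕜] Y₁) → X₁ →L[𝕜] Y₁) →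
      HasFredholmIndex (R : X →ₗ[𝕜] Y)
        ((Module.finrank 𝕜 X₀ : ℤ) - Module.finrank 𝕜 Y₀) := by
    rintro R ⟨α, hα⟩
    let M : X₁ × X₀ →ₗ[𝕜] Y₁ × Y₀ :=
      (f.symm : Y →ₗ[𝕜] Y₁ × Y₀) ∘ₗ (R : X →ₗ[𝕜] Y) ∘ₗ (e : X₁ × X₀ →ₗ[𝕜] X)
    rw [hasFredholmIndex_conj (R : X →ₗ[𝕜] Y) M e.symm.toLinearEquiv f.symm.toLinearEquiv
      (by simp [M])]
    rw [hasFredholmIndex_schurComplement M α.toLinearEquiv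
      (LinearMap.fst 𝕜 _ _ ∘ₗ M ∘ₗ LinearMap.inr 𝕜 _ _)
      (LinearMap.snd 𝕜 _ _ ∘ₗ M ∘ₗ LinearMap.inl 𝕜 _ _)
      (LinearMap.snd 𝕜 _ _ ∘ₗ M ∘ₗ LinearMap.inr 𝕜 _ _)]
    · exact hasFredholmIndex_of_finiteDimensional _
    · intro v x
      have hαv : α v = (M (v, 0)).1 := congrArg (fun u : X₁ →L[𝕜] Y₁ => u v) hα
      have hvx : M (v, x) = M (v, 0) + M (0, x) := by rw [← map_add]; simp
      rw [hvx]
      ext <;> simp [hαv]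
  obtain rfl := hT.unique (key T ⟨a, hcorner.symm⟩)
  have : ∀ᶠ R in 𝓝 T, corner R ∈ Set.range ((↑) : (X₁ ≃L[𝕜] Y₁) → X₁ →L[𝕜] Y₁) :=
    hcont.continuousAt.eventually (by rw [hcorner]; exact ContinuousLinearEquiv.nhds a)
  exact this.mono key

/-- The index is constant along a path of Fredholm operators. -/
theorem hasFredholmIndex_of_path {γ : ℝ → X →L[𝕜] Y} (hγ : Continuous γ)
    (hF : ∀ t, (γ t).IsFredholm) {k : ℤ} {s : ℝ} (hs : HasFredholmIndex (γ s : X →ₗ[𝕜] Y) k)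
    (t : ℝ) : HasFredholmIndex (γ t : X →ₗ[𝕜] Y) k := by
  have hloc : IsLocallyConstant fun t => index (γ t) := by
    rw [IsLocallyConstant.iff_eventually_eq]
    intro t
    filter_upwards [hγ.continuousAt.eventually
      (eventually_hasFredholmIndex (hasFredholmIndex_index (hF t)))] with r
      (hr : HasFredholmIndex (γ r : X →ₗ[𝕜] Y) _)
    exact hr.2.2
  have h := hloc.apply_eq_of_preconnectedSpace s t
  have hk : index (γ s) = k := hs.2.2
  rw [← hk, h]
  exact hasFredholmIndex_index (hF t)

theorem hasFredholmIndex_of_equiv {T T' : X →L[𝕜] Y} {k : ℤ}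
    (hT : HasFredholmIndex (T : X →ₗ[𝕜] Y) k)
    (h : (T' : X →ₗ[𝕜] Y) ≈ (T : X →ₗ[𝕜] Y)) : HasFredholmIndex (T' : X →ₗ[𝕜] Y) k := by
  have hTF : T.IsFredholm := (mem_fredholmOfIndex_iff.mpr hT).1
  have := hasFredholmIndex_of_path (𝕜 := 𝕜) (γ := fun t : ℝ => T + (t : 𝕜) • (T' - T))
    (by fun_prop) (fun t => isFredholm_of_equiv hTF ?_) (s := 0) (k := k) (by simpa using hT) 1
  · simpa using this
  · rw [equiv_iff_hasNoetherianRange] at h ⊢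
    simpa using h.smul (c := (t : 𝕜))

/-- A Fredholm operator of index zero is an isomorphism up to a finite rank operator. -/
theorem exists_equiv_of_index_zero {T : X →L[𝕜] Y} (hT : HasFredholmIndex (T : X →ₗ[𝕜] Y) 0) :
    ∃ J : X ≃L[𝕜] Y, ((J : X →L[𝕜] Y) : X →ₗ[𝕜] Y) ≈ (T : X →ₗ[𝕜] Y) := by
  obtain ⟨X₁, X₀, Y₁, Y₀, _, _, _, e, f, a, h⟩ :=
    exists_fredholm_normal_form (mem_fredholmOfIndex_iff.mpr hT).1
  have hdim : Module.finrank 𝕜 X₀ = Module.finrank 𝕜 Y₀ := by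
    have h1 : HasFredholmIndex (T : X →ₗ[𝕜] Y)
        ((Module.finrank 𝕜 X₀ : ℤ) - Module.finrank 𝕜 Y₀) := by
      rw [hasFredholmIndex_conj (T : X →ₗ[𝕜] Y)
        ((a : X₁ →ₗ[𝕜] Y₁).prodMap (0 : X₀ →ₗ[𝕜] Y₀))
        e.symm.toLinearEquiv f.symm.toLinearEquiv, hasFredholmIndex_schurComplement _
        a.toLinearEquiv 0 0 0]
      · exact hasFredholmIndex_of_finiteDimensional _
      · intro v x
        simp
      · intro x
        obtain ⟨⟨v, x⟩, rfl⟩ := e.surjective x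
        simp [h]
    have := hT.unique h1
    omega
  obtain ⟨j⟩ := FiniteDimensional.nonempty_continuousLinearEquiv_of_finrank_eq (𝕜 := 𝕜) hdim
  let J : X ≃L[𝕜] Y := (e.symm.trans (a.prodCongr j)).trans f
  refine ⟨J, ?_⟩
  rw [equiv_iff_hasNoetherianRange]
  have : ((J : X →L[𝕜] Y) : X →ₗ[𝕜] Y) - (T : X →ₗ[𝕜] Y) =
      ((f : Y₁ × Y₀ →ₗ[𝕜] Y) ∘ₗ LinearMap.inr 𝕜 Y₁ Y₀ ∘ₗ (j : X₀ →ₗ[𝕜] Y₀)) ∘ₗ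
        (LinearMap.snd 𝕜 X₁ X₀ ∘ₗ (e.symm : X →ₗ[𝕜] X₁ × X₀)) := by
    ext x
    obtain ⟨⟨v, x⟩, rfl⟩ := e.surjective x
    simp [h, J, ← map_sub]
  rw [this]
  exact LinearMap.HasNoetherianRange.of_isNoetherian_dom.comp_right _

end Analysis

section Transfer

variable {𝕜 : Type*} [RCLike 𝕜]
  {X : Type*} [NormedAddCommGroup X] [NormedSpace 𝕜 X] [CompleteSpace X]
  {Y : Type*} [NormedAddCommGroup Y] [NormedSpace 𝕜 Y]
  {X' : Type*} [NormedAddCommGroup X'] [NormedSpace 𝕜 X'] [CompleteSpace X']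
  {Y' : Type*} [NormedAddCommGroup Y'] [NormedSpace 𝕜 Y'] [CompleteSpace Y']

/-- Schur coupled Fredholm operators of index `k` yield an operator `I - S T` of index `k`. -/
theorem exists_id_sub_comp_of_mem_schurIndices {k : ℤ} (hk : k ∈ schurIndices 𝕜 X Y) :
    ∃ (S : Y →L[𝕜] X) (T : X →L[𝕜] Y),
      ContinuousLinearMap.id 𝕜 X - S ∘L T ∈ fredholmOfIndex 𝕜 X X k := by
  obtain ⟨⟨U, V⟩, hU, -, A, D, B, C, hUA, -⟩ := hk
  dsimp only at hU hUA
  refine ⟨(A.symm : X →L[𝕜] X) ∘L B, (D.symm : Y →L[𝕜] Y) ∘L C, ?_⟩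
  rw [mem_fredholmOfIndex_iff] at hU ⊢
  refine (hasFredholmIndex_conj _ _ (LinearEquiv.refl 𝕜 X) A.symm.toLinearEquiv ?_ k).mp hU
  intro x
  simp [hUA]

variable [CompleteSpace Y]

theorem conj_mem_fredholmOfIndex (e : X ≃L[𝕜] X') {T : X →L[𝕜] X} {k : ℤ}
    (hT : T ∈ fredholmOfIndex 𝕜 X X k) :
    (e : X →L[𝕜] X') ∘L T ∘L (e.symm : X' →L[𝕜] X) ∈ fredholmOfIndex 𝕜 X' X' k := by
  rw [mem_fredholmOfIndex_iff] at hT ⊢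
  exact (hasFredholmIndex_conj _ _ e.toLinearEquiv e.toLinearEquiv (by simp) k).mp hT

theorem fredholmIndices_subset_of_equiv (e : X ≃L[𝕜] X') :
    fredholmIndices 𝕜 X ⊆ fredholmIndices 𝕜 X' :=
  fun _ ⟨_, hT⟩ => ⟨_, conj_mem_fredholmOfIndex e hT⟩

theorem fredholmIndices_congr (e : X ≃L[𝕜] X') :
    fredholmIndices 𝕜 X = fredholmIndices 𝕜 X' :=
  (fredholmIndices_subset_of_equiv e).antisymm (fredholmIndices_subset_of_equiv e.symm)

theorem schurIndices_subset_of_equiv (e : X ≃L[𝕜] X') (f : Y ≃L[𝕜] Y') :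
    schurIndices 𝕜 X Y ⊆ schurIndices 𝕜 X' Y' := by
  rintro k ⟨⟨U, V⟩, hU, hV, A, D, B, C, hUA, hVD⟩
  dsimp only at hU hV hUA hVD
  refine ⟨⟨_, _⟩, conj_mem_fredholmOfIndex e hU, conj_mem_fredholmOfIndex f hV,
    (e.symm.trans A).trans e, (f.symm.trans D).trans f,
    (e : X →L[𝕜] X') ∘L B ∘L (f.symm : Y' →L[𝕜] Y),
    (f : Y →L[𝕜] Y') ∘L C ∘L (e.symm : X' →L[𝕜] X), ?_, ?_⟩
  · ext x
    simp [hUA]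
  · ext y
    simp [hVD]

theorem schurIndices_congr (e : X ≃L[𝕜] X') (f : Y ≃L[𝕜] Y') :
    schurIndices 𝕜 X Y = schurIndices 𝕜 X' Y' :=
  (schurIndices_subset_of_equiv e f).antisymm (schurIndices_subset_of_equiv e.symm f.symm)

end Transfer

section Incomparable

open LinearMap.FiniteRangeSetoid

variable {𝕜 : Type*} [RCLike 𝕜]
  {X : Type*} [NormedAddCommGroup X] [NormedSpace 𝕜 X]
  {Y : Type*} [NormedAddCommGroup Y] [NormedSpace 𝕜 Y]
  {Z : Type*} [NormedAddCommGroup Z] [NormedSpace 𝕜 Z]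

theorem isFredholm_id_sub_comp_sub_comp (hY : EssentiallyIncomparable 𝕜 X Y)
    (hZ : EssentiallyIncomparable 𝕜 X Z) (S : Y →L[𝕜] X) (T : X →L[𝕜] Y) (S' : Z →L[𝕜] X)
    (T' : X →L[𝕜] Z) :
    (ContinuousLinearMap.id 𝕜 X - S ∘L T - S' ∘L T').IsFredholm := by
  obtain ⟨v, hv⟩ := (hY S T).exists_isQuasiInverse
  refine isFredholm_of_equiv (isFredholm_comp (hY S T) (hZ (v ∘L S') T')) ?_
  have h := equiv_iff_hasNoetherianRange.mp hv.2.equiv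
  rw [equiv_iff_hasNoetherianRange]
  have heq : ∀ A : X →L[𝕜] X,
      ((A - S' ∘L T' : X →L[𝕜] X) : X →ₗ[𝕜] X) -
        ((A ∘L (ContinuousLinearMap.id 𝕜 X - (v ∘L S') ∘L T') : X →L[𝕜] X) : X →ₗ[𝕜] X) =
      ((A : X →ₗ[𝕜] X) ∘ₗ (v : X →ₗ[𝕜] X) - LinearMap.id) ∘ₗ
        ((S' ∘L T' : X →L[𝕜] X) : X →ₗ[𝕜] X) := by
    intro A
    ext x
    simp
  rw [heq]
  exact h.comp_right _

variable [CompleteSpace X]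

theorem hasFredholmIndex_id_sub_comp_sub_comp (hY : EssentiallyIncomparable 𝕜 X Y)
    (hZ : EssentiallyIncomparable 𝕜 X Z) (S : Y →L[𝕜] X) (T : X →L[𝕜] Y) (S' : Z →L[𝕜] X)
    (T' : X →L[𝕜] Z) :
    HasFredholmIndex ((ContinuousLinearMap.id 𝕜 X - S ∘L T - S' ∘L T' : X →L[𝕜] X) :
      X →ₗ[𝕜] X) 0 := by
  have hid : HasFredholmIndex ((ContinuousLinearMap.id 𝕜 X : X →L[𝕜] X) : X →ₗ[𝕜] X) 0 := by
    have hker : LinearMap.ker (LinearMap.id : X →ₗ[𝕜] X) = ⊥ := LinearMap.ker_id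
    have hrange : LinearMap.range (LinearMap.id : X →ₗ[𝕜] X) = ⊤ := LinearMap.range_id
    rw [ContinuousLinearMap.coe_id, HasFredholmIndex, hker, hrange]
    have : Subsingleton (X ⧸ (⊤ : Submodule 𝕜 X)) :=
      Submodule.Quotient.subsingleton_iff.mpr rfl
    exact ⟨inferInstance, inferInstance, by simp [Module.finrank_zero_of_subsingleton]⟩
  have := hasFredholmIndex_of_path (𝕜 := 𝕜)
    (γ := fun t : ℝ => ContinuousLinearMap.id 𝕜 X - ((t : 𝕜) • S) ∘L T - ((t : 𝕜) • S') ∘L T')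
    (by fun_prop) (fun t => isFredholm_id_sub_comp_sub_comp hY hZ _ _ _ _) (s := 0) (k := 0)
    (by simpa using hid) 1
  simpa using this

variable [CompleteSpace Y]

/-- A Fredholm operator on a product whose upper left corner is Fredholm of index zero has the index
of some Fredholm operator on the second factor. -/
theorem mem_fredholmIndices_of_corner {M : X × Y →L[𝕜] X × Y} {k : ℤ}
    (hM : M ∈ fredholmOfIndex 𝕜 (X × Y) (X × Y) k)
    (hcorner : HasFredholmIndex ((ContinuousLinearMap.fst 𝕜 X Y ∘L M ∘L
      ContinuousLinearMap.inl 𝕜 X Y : X →L[𝕜] X) : X →ₗ[𝕜] X) 0) :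
    k ∈ fredholmIndices 𝕜 Y := by
  obtain ⟨J, hJ⟩ := exists_equiv_of_index_zero hcorner
  let b : Y →L[𝕜] X := ContinuousLinearMap.fst 𝕜 X Y ∘L M ∘L ContinuousLinearMap.inr 𝕜 X Y
  let c : X →L[𝕜] Y := ContinuousLinearMap.snd 𝕜 X Y ∘L M ∘L ContinuousLinearMap.inl 𝕜 X Y
  let d : Y →L[𝕜] Y := ContinuousLinearMap.snd 𝕜 X Y ∘L M ∘L ContinuousLinearMap.inr 𝕜 X Y
  let N : X × Y →L[𝕜] X × Y :=
    ((J : X →L[𝕜] X).coprod b).prod (c.coprod d)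
  have hMsplit : ∀ x y, M (x, y) = M (x, 0) + M (0, y) := by
    intro x y
    rw [← map_add]
    simp
  have hN : (N : X × Y →ₗ[𝕜] X × Y) ≈ (M : X × Y →ₗ[𝕜] X × Y) := by
    rw [equiv_iff_hasNoetherianRange] at hJ ⊢
    refine Eq.subst (motive := LinearMap.HasNoetherianRange) ?_
      ((hJ.comp_right (LinearMap.fst 𝕜 X Y)).comp_left (LinearMap.inl 𝕜 X Y))
    refine LinearMap.ext fun ⟨x, y⟩ => Eq.symm ?_
    rw [LinearMap.sub_apply, ContinuousLinearMap.coe_coe, ContinuousLinearMap.coe_coe, hMsplit]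
    ext <;> simp [N, b, c, d]
  have hNk := hasFredholmIndex_of_equiv (mem_fredholmOfIndex_iff.mp hM) hN
  rw [hasFredholmIndex_schurComplement (N : X × Y →ₗ[𝕜] X × Y) J.toLinearEquiv b c d
    (by simp [N])] at hNk
  exact ⟨d - c ∘L (J.symm : X →L[𝕜] X) ∘L b, mem_fredholmOfIndex_iff.mpr hNk⟩

variable [CompleteSpace Z]

theorem id_prodMap_mem_fredholmOfIndex (X : Type*) [NormedAddCommGroup X] [NormedSpace 𝕜 X]
    [CompleteSpace X] {W : Z →L[𝕜] Z} {k : ℤ} (hW : W ∈ fredholmOfIndex 𝕜 Z Z k) :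
    (ContinuousLinearMap.id 𝕜 X).prodMap W ∈ fredholmOfIndex 𝕜 (X × Z) (X × Z) k := by
  rw [mem_fredholmOfIndex_iff] at hW ⊢
  rw [hasFredholmIndex_schurComplement _ (LinearEquiv.refl 𝕜 X) 0 0 (W : Z →ₗ[𝕜] Z) (by simp)]
  simpa using hW

/-- `𝕀_SC` of two spaces with a common direct summand. -/
theorem schurIndices_prod (hY : EssentiallyIncomparable 𝕜 X Y)
    (hZ : EssentiallyIncomparable 𝕜 X Z) :
    schurIndices 𝕜 (X × Z) (Y × Z) = fredholmIndices 𝕜 Z := by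
  refine Set.Subset.antisymm (fun k hk => ?_) ?_
  · obtain ⟨S, T, h⟩ := exists_id_sub_comp_of_mem_schurIndices hk
    refine mem_fredholmIndices_of_corner h ?_
    convert hasFredholmIndex_id_sub_comp_sub_comp hY hZ
      (ContinuousLinearMap.fst 𝕜 X Z ∘L S ∘L ContinuousLinearMap.inl 𝕜 Y Z)
      (ContinuousLinearMap.fst 𝕜 Y Z ∘L T ∘L ContinuousLinearMap.inl 𝕜 X Z)
      (ContinuousLinearMap.fst 𝕜 X Z ∘L S ∘L ContinuousLinearMap.inr 𝕜 Y Z)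
      (ContinuousLinearMap.snd 𝕜 Y Z ∘L T ∘L ContinuousLinearMap.inl 𝕜 X Z) using 2
    ext x
    have hS : S (T (x, 0)) = S ((T (x, 0)).1, 0) + S (0, (T (x, 0)).2) := by
      rw [← map_add]
      simp
    simp [hS]
    abel
  · rintro k ⟨W, hW⟩
    refine ⟨⟨_, _⟩, id_prodMap_mem_fredholmOfIndex X hW, id_prodMap_mem_fredholmOfIndex Y hW,
      .refl 𝕜 _, .refl 𝕜 _, (0 : Y →L[𝕜] X).prodMap (ContinuousLinearMap.id 𝕜 Z),
      (0 : X →L[𝕜] Y).prodMap (ContinuousLinearMap.id 𝕜 Z - W), ?_, ?_⟩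
    · refine ContinuousLinearMap.ext fun p => ?_
      ext <;> simp
    · refine ContinuousLinearMap.ext fun p => ?_
      ext <;> simp

end Incomparable

end SchurFredholm

theorem proposition1p9 {𝕜 : Type*} [RCLike 𝕜]
    {X : Type*} [NormedAddCommGroup X] [NormedSpace 𝕜 X] [CompleteSpace X]
    {Y : Type*} [NormedAddCommGroup Y] [NormedSpace 𝕜 Y] [CompleteSpace Y]
    (X₁ X₂ : Submodule 𝕜 X) (Y₁ Y₂ : Submodule 𝕜 Y)
    (hX₁ : IsClosed (X₁ : Set X)) (hX₂ : IsClosed (X₂ : Set X)) (hX : IsCompl X₁ X₂)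
    (hY₁ : IsClosed (Y₁ : Set Y)) (hY₂ : IsClosed (Y₂ : Set Y)) (hY : IsCompl Y₁ Y₂)
    (hiso : Nonempty (X₂ ≃L[𝕜] Y₂))
    (h₁₂ : SchurFredholm.EssentiallyIncomparable 𝕜 X₁ X₂)
    (h₁₁ : SchurFredholm.EssentiallyIncomparable 𝕜 X₁ Y₁)
    (h₂₁ : SchurFredholm.EssentiallyIncomparable 𝕜 X₂ Y₁) :
    SchurFredholm.schurIndices 𝕜 X Y = SchurFredholm.fredholmIndices 𝕜 X₂ ∧
      SchurFredholm.sc 𝕜 X Y = SchurFredholm.eae 𝕜 X₂ Y₂ := by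
  obtain ⟨j⟩ := hiso
  have := hX₁.completeSpace_coe
  have := hX₂.completeSpace_coe
  have := hY₁.completeSpace_coe
  have := hY₂.completeSpace_coe
  have e : X ≃L[𝕜] X₁ × X₂ := (X₁.prodEquivOfIsTopCompl X₂
    (Submodule.IsCompl.isTopCompl_of_isClosed hX hX₁ hX₂)).symm
  have f : Y ≃L[𝕜] Y₁ × X₂ := (Y₁.prodEquivOfIsTopCompl Y₂
    (Submodule.IsCompl.isTopCompl_of_isClosed hY hY₁ hY₂)).symm.trans
      ((ContinuousLinearEquiv.refl 𝕜 Y₁).prodCongr j.symm)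
  have h : SchurFredholm.schurIndices 𝕜 X Y = SchurFredholm.fredholmIndices 𝕜 X₂ :=
    (SchurFredholm.schurIndices_congr e f).trans (SchurFredholm.schurIndices_prod h₁₁ h₁₂)
  refine ⟨h, ?_⟩
  rw [SchurFredholm.sc, SchurFredholm.eae, h, ← SchurFredholm.fredholmIndices_congr j,
    Set.inter_self]
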